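/- Let $X$ be a real Banach space, equip $\mathbb{R}^m$ with the maximum norm and write $|A|$ for the Lebesgue measure of $A$, $A^o$ for its interior, $B(t,r)$ for the open ball. An interval is a set $\prod_{j=1}^m[a_j,b_j]$ with $a_j<b_j$ for all $j$. Intervals $I,J$ are non-overlapping if $I^o\cap J^o=\emptyset$. For $E\subset\mathbb{R}^m$ let $\mathcal{I}_E$ be the set of all intervals contained in $E$. A division in $E$ is a sequence $(I_k)_{k\in\mathbb N}$ of pairwise non-overlapping members of $\mathcal{I}_E$; it is a division of $E$ if moreover $E=\bigcup_k I_k$. An $\mathcal{M}$-partition in $E$ is a finite set $\pi$ of pairs $(t,I)$ with $t\in E$ and $I\in\mathcal{I}_E$ ($t\in I$ is not required) whose intervals are pairwise non-overlapping. A gauge on $Z$ is a function $\delta:Z\to(0,\infty)$. If all tags $t$ of $\pi$ lie in $Z$, then $\pi$ is called $Z$-tagged, and it is $\delta$-fine if $I\subset B(t,\delta(t))$ for all $(t,I)\in\pi$. A function $F:\mathcal{I}_E\to X$ is additive if $F(I\cup J)=F(I)+F(J)$ for all non-overlapping $I,J\in\mathcal{I}_E$ with $I\cup J\in\mathcal{I}_E$.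 An additive $F$ is a Dunford-function if for every division $(I_k)$ in $E$ and every $I\in\mathcal{I}_{\mathbb{R}^m}$ the series $\sum_{k:|I\cap I_k|>0}F(I\cap I_k)$ is unconditionally convergent in $X$, and if for every division $(I_k)$ of $E^o$ and every $I\in\mathcal{I}_E$ one has $F(I)=\sum_{k:|I\cap I_k|>0}F(I\cap I_k)$. An additive $F$ has $\mathcal{M}$-negligible variation outside of $E^o$ if for each $\varepsilon>0$ there is a gauge $\delta$ on $\mathbb{R}^m\setminus E^o$ such that, for each $(\mathbb{R}^m\setminus E^o)$-tagged $\delta$-fine $\mathcal{M}$-partition $\pi$ in $\mathbb{R}^m$ and each division $(I_k)$ of $E^o$, the series $\sum_{k:|I\cap I_k|>0}F(I\cap I_k)$ is unconditionally convergent for each $(t,I)\in\pi$ and $$\Big\|\sum_{(t,I)\in\pi}\ \sum_{k:|I\cap I_k|>0}F(I\cap I_k)\Big\|<\varepsilon .$$ A function $f:E\to X$ is Dunford–McShane integrable on $E$ with the primitive $F:\mathcal{I}_E\to X$ if (a) for each $\varepsilon>0$ there is a gauge $\delta$ on $E^o$ such that $\big\|\sum_{(t,I)\in\pi}(f(t)|I|-F(I))\big\|<\varepsilon$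 for each $\delta$-fine $\mathcal{M}$-partition $\pi$ in $E^o$, (b) $F$ is a Dunford-function, and (c) $F$ has $\mathcal{M}$-negligible variation outside of $E^o$. **Corollary 2.1.** Let $G\subset\mathbb{R}^m$ be bounded with $G^o\neq\emptyset$ and $|G\setminus G^o|=0$. Let $f,h:G\to X$ be Dunford–McShane integrable on $G$ with the primitives $F$ and $H$, respectively. Then (i) $f+h$ is Dunford–McShane integrable on $G$ with the primitive $F+H$; (ii) for every $r\in\mathbb{R}$, $r f$ is Dunford–McShane integrable on $G$ with the primitive $rF$. -/

import Mathlib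

open MeasureTheory

namespace DunfordMcShane

/-- `I` is a closed non-degenerate interval `∏ [a j, b j]`, `a j < b j`, in `ℝᵐ`.
The space `Fin m → ℝ` carries the maximum norm. -/
def IsNondegInterval {m : ℕ} (I : Set (Fin m → ℝ)) : Prop :=
  ∃ a b : Fin m → ℝ, (∀ j, a j < b j) ∧ I = Set.Icc a b

/-- The family of all closed non-degenerate intervals contained in `E`. -/
abbrev Cell {m : ℕ} (E : Set (Fin m → ℝ)) : Type :=
  {I : Set (Fin m → ℝ) // IsNondegInterval I ∧ I ⊆ E}

theorem IsNondegInterval.inter {m : ℕ} {I J : Set (Fin m → ℝ)} (hI : IsNondegInterval I)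
    (hJ : IsNondegInterval J) (h : 0 < volume (I ∩ J)) : IsNondegInterval (I ∩ J) := by
  obtain ⟨a, b, -, rfl⟩ := hI
  obtain ⟨c, d, -, rfl⟩ := hJ
  rw [Set.Icc_inter_Icc] at h ⊢
  refine ⟨_, _, fun j => ?_, rfl⟩
  by_contra hj
  rw [Real.volume_Icc_pi] at h
  refine h.ne' (Finset.prod_eq_zero (Finset.mem_univ j) ?_)
  exact ENNReal.ofReal_eq_zero.2 (sub_nonpos.2 (not_lt.1 hj))

/-- An interval contained in `A`, seen as an interval contained in a larger set `E`. -/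
def Cell.mono {m : ℕ} {A E : Set (Fin m → ℝ)} (hAE : A ⊆ E) (I : Cell A) : Cell E :=
  ⟨I.1, I.2.1, I.2.2.trans hAE⟩

/-- The intersection of an interval `I` with an interval `J` contained in `E`, when it has
positive measure, is an interval contained in `E`. -/
def Cell.inter {m : ℕ} {A E : Set (Fin m → ℝ)} (I : Cell A) (J : Cell E)
    (h : 0 < volume (I.1 ∩ J.1)) : Cell E :=
  ⟨I.1 ∩ J.1, I.2.1.inter J.2.1 h, Set.inter_subset_right.trans J.2.2⟩

/-- Two intervals are non-overlapping if their interiors are disjoint. -/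
def NonOverlapping {m : ℕ} (I J : Set (Fin m → ℝ)) : Prop :=
  interior I ∩ interior J = ∅

/-- Additive interval functions. -/
def IsAdditive {m : ℕ} {X : Type*} [AddCommGroup X] {E : Set (Fin m → ℝ)}
    (F : Cell E → X) : Prop :=
  ∀ I J K : Cell E, NonOverlapping I.1 J.1 → K.1 = I.1 ∪ J.1 → F K = F I + F J

/-- A division in `E`: a sequence of pairwise non-overlapping intervals contained in `E`. -/
def IsDivisionIn {m : ℕ} {E : Set (Fin m → ℝ)} (C : ℕ → Cell E) : Prop :=
  Pairwise fun i j => NonOverlapping (C i).1 (C j).1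

/-- A division of `E`: a division in `E` whose union is `E`. -/
def IsDivisionOf {m : ℕ} {E : Set (Fin m → ℝ)} (C : ℕ → Cell E) : Prop :=
  IsDivisionIn C ∧ E = ⋃ k, (C k).1

/-- The indices `k` with `|I ∩ C k| > 0`. -/
abbrev MeetIndex {m : ℕ} {A E : Set (Fin m → ℝ)} (I : Cell A) (C : ℕ → Cell E) : Type :=
  {k : ℕ // 0 < volume (I.1 ∩ (C k).1)}

/-- The terms `F (I ∩ C k)`, indexed by the `k` with `|I ∩ C k| > 0`. In a Banach space the
`Summable` families over such an index set are the unconditionally convergent series. -/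
def pieces {m : ℕ} {X : Type*} {A E : Set (Fin m → ℝ)} (F : Cell E → X) (I : Cell A)
    (C : ℕ → Cell E) : MeetIndex I C → X :=
  fun k => F (I.inter (C k.1) k.2)

/-- Dunford-functions. -/
def IsDunfordFunction {m : ℕ} {X : Type*} [NormedAddCommGroup X] {E : Set (Fin m → ℝ)}
    (F : Cell E → X) : Prop :=
  IsAdditive F ∧
  (∀ C : ℕ → Cell E, IsDivisionIn C →
    ∀ I : Cell (Set.univ : Set (Fin m → ℝ)), Summable (pieces F I C)) ∧
  (∀ C : ℕ → Cell (interior E), IsDivisionOf C →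
    ∀ I : Cell E, F I = ∑' k, pieces F I (fun k => (C k).mono interior_subset) k)

/-- A gauge on `Z` is a positive function on `Z`; values off `Z` are never used. -/
def IsGauge {m : ℕ} (Z : Set (Fin m → ℝ)) (δ : (Fin m → ℝ) → ℝ) : Prop :=
  ∀ t ∈ Z, 0 < δ t

/-- A finite collection of pairs `(t, I)`, with `t ∈ E` and `I` an interval contained in `E`,
is an `M`-partition in `E` if its intervals are pairwise non-overlapping.
The tag `t` need not belong to `I`. -/
def IsMPartition {m : ℕ} {E : Set (Fin m → ℝ)} (π : Finset (E × Cell E)) : Prop :=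
  (π : Set (E × Cell E)).Pairwise fun p q => NonOverlapping p.2.1 q.2.1

/-- All tags of `π` lie in `Z`. -/
def IsTagged {m : ℕ} {E : Set (Fin m → ℝ)} (Z : Set (Fin m → ℝ))
    (π : Finset (E × Cell E)) : Prop :=
  ∀ p ∈ π, p.1.1 ∈ Z

/-- `π` is `δ`-fine. -/
def IsFine {m : ℕ} {E : Set (Fin m → ℝ)} (δ : (Fin m → ℝ) → ℝ)
    (π : Finset (E × Cell E)) : Prop :=
  ∀ p ∈ π, p.2.1 ⊆ Metric.ball p.1.1 (δ p.1.1)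

/-- `F` has `M`-negligible variation over `Z`. The gauge does not depend on the division. -/
def HasMNegligibleVariation {m : ℕ} {X : Type*} [NormedAddCommGroup X] {E : Set (Fin m → ℝ)}
    (F : Cell E → X) (Z : Set (Fin m → ℝ)) : Prop :=
  ∀ ε : ℝ, 0 < ε → ∃ δ : (Fin m → ℝ) → ℝ, IsGauge Z δ ∧
    ∀ π : Finset (↥(Set.univ : Set (Fin m → ℝ)) × Cell (Set.univ : Set (Fin m → ℝ))),
      IsMPartition π → IsTagged Z π → IsFine δ π →
      ∀ C : ℕ → Cell (interior E), IsDivisionOf C →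
        (∀ p ∈ π, Summable (pieces F p.2 (fun k => (C k).mono interior_subset))) ∧
        ‖∑ p ∈ π, ∑' k, pieces F p.2 (fun k => (C k).mono interior_subset) k‖ < ε

/-- `f : E → X` is Dunford–McShane integrable on `E` with the primitive `F`. -/
def IsDMIntegrable {m : ℕ} {X : Type*} [NormedAddCommGroup X] [NormedSpace ℝ X]
    {E : Set (Fin m → ℝ)} (f : E → X) (F : Cell E → X) : Prop :=
  (∀ ε : ℝ, 0 < ε → ∃ δ : (Fin m → ℝ) → ℝ, IsGauge (interior E) δ ∧
    ∀ π : Finset (interior E × Cell (interior E)), IsMPartition π → IsFine δ π →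
      ‖∑ p ∈ π, (volume.real p.2.1 • f (Set.inclusion interior_subset p.1) -
        F (p.2.mono interior_subset))‖ < ε) ∧
  IsDunfordFunction F ∧
  HasMNegligibleVariation F (interior E)ᶜ

end DunfordMcShane

namespace DunfordMcShane

section Group

variable {m : ℕ} {X : Type*} [AddCommGroup X] {A E : Set (Fin m → ℝ)}

/-! Every clause of the definition is linear in the pair `(f, F)`, so the primitives add and scale
with the functions. For a sum, each estimate is taken with `ε / 2` and the pointwise minimum of the
two gauges; for a multiple, with `ε / (|r| + 1)` and the same gauge. The only point beyond finite
algebra is that `∑'` is split only over summable families; the convergence clauses for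
Dunford-functions and for negligible variation provide this. -/

theorem IsAdditive.add {F H : Cell E → X} (hF : IsAdditive F) (hH : IsAdditive H) :
    IsAdditive (F + H) := fun I J K hIJ hK => by
  simp only [Pi.add_apply, hF I J K hIJ hK, hH I J K hIJ hK]
  abel

theorem IsAdditive.smul [Module ℝ X] {F : Cell E → X} (hF : IsAdditive F) (r : ℝ) :
    IsAdditive (r • F) := fun I J K hIJ hK => by
  simp only [Pi.smul_apply, hF I J K hIJ hK, smul_add]

/-- The index type depends on `I` and `C` alone, not on the interval function, so both families live
over the same indices. -/
theorem pieces_add (F H : Cell E → X) (I : Cell A) (C : ℕ → Cell E) :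
    pieces (F + H) I C = pieces F I C + pieces H I C := rfl

theorem pieces_smul [Module ℝ X] (r : ℝ) (F : Cell E → X) (I : Cell A) (C : ℕ → Cell E) :
    pieces (r • F) I C = r • pieces F I C := rfl

theorem IsGauge.min {Z : Set (Fin m → ℝ)} {δ η : (Fin m → ℝ) → ℝ} (hδ : IsGauge Z δ)
    (hη : IsGauge Z η) : IsGauge Z fun t => min (δ t) (η t) :=
  fun t ht => lt_min (hδ t ht) (hη t ht)

theorem IsFine.mono {δ η : (Fin m → ℝ) → ℝ} {π : Finset (E × Cell E)} (h : IsFine δ π)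
    (hδ : ∀ t, δ t ≤ η t) : IsFine η π :=
  fun p hp => (h p hp).trans (Metric.ball_subset_ball (hδ _))

end Group

variable {m : ℕ} {X : Type*} [NormedAddCommGroup X] {E : Set (Fin m → ℝ)}

/-- A Dunford-function has unconditionally convergent sums of pieces along divisions of the
interior, in whichever set the cut interval lies. -/
theorem IsDunfordFunction.summable_pieces {A : Set (Fin m → ℝ)} {F : Cell E → X}
    (hF : IsDunfordFunction F) {C : ℕ → Cell (interior E)} (hC : IsDivisionOf C) (I : Cell A) :
    Summable (pieces F I fun k => (C k).mono interior_subset) :=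
  -- Enlarging the ambient set leaves the underlying sets unchanged, hence also non-overlap, the
  -- indices and the pieces.
  hF.2.1 (fun k => (C k).mono interior_subset) hC.1 (I.mono (Set.subset_univ A))

theorem IsDunfordFunction.add {F H : Cell E → X} (hF : IsDunfordFunction F)
    (hH : IsDunfordFunction H) : IsDunfordFunction (F + H) := by
  refine ⟨hF.1.add hH.1, fun C hC I => (hF.2.1 C hC I).add (hH.2.1 C hC I), fun C hC I => ?_⟩
  rw [Pi.add_apply, hF.2.2 C hC I, hH.2.2 C hC I, pieces_add]
  exact ((hF.summable_pieces hC I).tsum_add (hH.summable_pieces hC I)).symm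

theorem IsDunfordFunction.smul [NormedSpace ℝ X] {F : Cell E → X} (hF : IsDunfordFunction F)
    (r : ℝ) : IsDunfordFunction (r • F) := by
  refine ⟨hF.1.smul r, fun C hC I => (hF.2.1 C hC I).const_smul r, fun C hC I => ?_⟩
  rw [Pi.smul_apply, hF.2.2 C hC I, pieces_smul]
  exact ((hF.summable_pieces hC I).tsum_const_smul r).symm

theorem HasMNegligibleVariation.add {F H : Cell E → X} {Z : Set (Fin m → ℝ)}
    (hF : HasMNegligibleVariation F Z) (hH : HasMNegligibleVariation H Z) :
    HasMNegligibleVariation (F + H) Z := fun ε hε => by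
  obtain ⟨δ, hδ, hFδ⟩ := hF (ε / 2) (half_pos hε)
  obtain ⟨η, hη, hHη⟩ := hH (ε / 2) (half_pos hε)
  -- The minimum is fixed before `C` appears: neither gauge depends on the division.
  refine ⟨_, hδ.min hη, fun π hπ hZ hfine C hC => ?_⟩
  obtain ⟨hFs, hFn⟩ := hFδ π hπ hZ (hfine.mono fun _ => min_le_left _ _) C hC
  obtain ⟨hHs, hHn⟩ := hHη π hπ hZ (hfine.mono fun _ => min_le_right _ _) C hC
  refine ⟨fun p hp => (hFs p hp).add (hHs p hp), ?_⟩
  have hsum : ∑ p ∈ π, ∑' k, pieces (F + H) p.2 (fun k => (C k).mono interior_subset) k =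
      ∑ p ∈ π, ∑' k, pieces F p.2 (fun k => (C k).mono interior_subset) k +
        ∑ p ∈ π, ∑' k, pieces H p.2 (fun k => (C k).mono interior_subset) k := by
    rw [← Finset.sum_add_distrib]
    exact Finset.sum_congr rfl fun p hp => (hFs p hp).tsum_add (hHs p hp)
  rw [hsum]
  linarith [norm_add_le (∑ p ∈ π, ∑' k, pieces F p.2 (fun k => (C k).mono interior_subset) k)
    (∑ p ∈ π, ∑' k, pieces H p.2 (fun k => (C k).mono interior_subset) k)]

/-- The `+ 1` keeps the denominator positive, so `r = 0` needs no separate treatment. -/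
theorem norm_smul_lt_of_lt_div [NormedSpace ℝ X] {r ε : ℝ} {x : X}
    (h : ‖x‖ < ε / (|r| + 1)) : ‖r • x‖ < ε := by
  rw [lt_div_iff₀ (by positivity)] at h
  rw [norm_smul, Real.norm_eq_abs]
  rcases (norm_nonneg x).eq_or_lt with hx | hx
  · rw [← hx] at h ⊢
    linarith
  · linarith

theorem HasMNegligibleVariation.smul [NormedSpace ℝ X] {F : Cell E → X} {Z : Set (Fin m → ℝ)}
    (hF : HasMNegligibleVariation F Z) (r : ℝ) : HasMNegligibleVariation (r • F) Z :=
  fun ε hε => by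
  obtain ⟨δ, hδ, hFδ⟩ := hF (ε / (|r| + 1)) (by positivity)
  refine ⟨δ, hδ, fun π hπ hZ hfine C hC => ?_⟩
  obtain ⟨hFs, hFn⟩ := hFδ π hπ hZ hfine C hC
  refine ⟨fun p hp => (hFs p hp).const_smul r, ?_⟩
  have hsum : ∑ p ∈ π, ∑' k, pieces (r • F) p.2 (fun k => (C k).mono interior_subset) k =
      r • ∑ p ∈ π, ∑' k, pieces F p.2 (fun k => (C k).mono interior_subset) k := by
    rw [Finset.smul_sum]
    exact Finset.sum_congr rfl fun p hp => (hFs p hp).tsum_const_smul r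
  rw [hsum]
  exact norm_smul_lt_of_lt_div hFn

theorem IsDMIntegrable.add [NormedSpace ℝ X] {f h : E → X} {F H : Cell E → X}
    (hf : IsDMIntegrable f F) (hh : IsDMIntegrable h H) : IsDMIntegrable (f + h) (F + H) := by
  refine ⟨fun ε hε => ?_, hf.2.1.add hh.2.1, hf.2.2.add hh.2.2⟩
  obtain ⟨δ, hδ, hfδ⟩ := hf.1 (ε / 2) (half_pos hε)
  obtain ⟨η, hη, hhη⟩ := hh.1 (ε / 2) (half_pos hε)
  refine ⟨_, hδ.min hη, fun π hπ hfine => ?_⟩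
  have h₁ := hfδ π hπ (hfine.mono fun _ => min_le_left _ _)
  have h₂ := hhη π hπ (hfine.mono fun _ => min_le_right _ _)
  simp only [Pi.add_apply, smul_add, add_sub_add_comm, Finset.sum_add_distrib]
  exact (norm_add_le _ _).trans_lt (by linarith)

theorem IsDMIntegrable.smul [NormedSpace ℝ X] {f : E → X} {F : Cell E → X}
    (hf : IsDMIntegrable f F) (r : ℝ) : IsDMIntegrable (r • f) (r • F) := by
  refine ⟨fun ε hε => ?_, hf.2.1.smul r, hf.2.2.smul r⟩
  obtain ⟨δ, hδ, hfδ⟩ := hf.1 (ε / (|r| + 1)) (by positivity)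
  refine ⟨δ, hδ, fun π hπ hfine => ?_⟩
  -- Volumes commute with `r`, so `r` factors out of the whole Riemann-type sum.
  simp only [Pi.smul_apply, smul_comm _ r, ← smul_sub, ← Finset.smul_sum]
  exact norm_smul_lt_of_lt_div (hfδ π hπ hfine)

end DunfordMcShane

theorem corollary2p1 {m : ℕ} {X : Type*} [NormedAddCommGroup X] [NormedSpace ℝ X]
    [CompleteSpace X] (G : Set (Fin m → ℝ)) (hG : Bornology.IsBounded G)
    (hG_int : (interior G).Nonempty) (hG_null : volume (G \ interior G) = 0)
    (f h : G → X) (F H : DunfordMcShane.Cell G → X)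
    (hf : DunfordMcShane.IsDMIntegrable f F) (hh : DunfordMcShane.IsDMIntegrable h H) :
    DunfordMcShane.IsDMIntegrable (f + h) (F + H) ∧
      ∀ r : ℝ, DunfordMcShane.IsDMIntegrable (r • f) (r • F) :=
  ⟨hf.add hh, hf.smul⟩
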